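/- A trunc is an archimedean real vector lattice $G$ (i.e. $0\le g$ and $ng\le h$ for all $n\in\mathbb N$ imply $g=0$) with a unary operation $g\mapsto\overline g$ on its positive cone $G^+$ such that, for all $g,h\in G^+$: $g\wedge\overline h\le\overline g\le g$; if $\overline g=0$ then $g=0$; and if $ng=\overline{ng}$ for all $n\in\mathbb N$ then $g=0$. Let $\overline G=\{\overline g: g\in G^+\}$. A truncation homomorphism is a vector lattice homomorphism which preserves this operation, and an isomorphism of truncs is an invertible truncation homomorphism. A unital component of $G$ is an element $u\in\overline G$ such that $(u\wedge g)\wedge(g-u\wedge g)=0$ for every $g\in\overline G$. A trunc is simple if each of its elements is a linear combination of unital components. A Boolean pointed space $(X,*)$ is a zero-dimensional compact Hausdorff space $X$ with a designated point $*$. The locally constant functions $f\colon X\to\mathbb R$ with $f(*)=0$ form a trunc $\mathcal{LC}X$ under the pointwise operations and the truncation $\overline f(x)=\min(f(x),1)$. Theorem. For every simple trunc $G$ there are a Boolean pointed space $(X,*)$ and a trunc isomorphism $\varphi\colon G\to\mathcal{LC}X$, and these are unique up to isomorphism: for every Boolean pointed space $(Y,*)$ and every trunc isomorphism $\psi\colon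 G\to\mathcal{LC}Y$ there is a unique homeomorphism $k\colon Y\to X$ such that $k(*)=*$ and $\psi(g)=\varphi(g)\circ k$ for all $g\in G$. -/

import Mathlib

universe u v

/-- An archimedean (real) vector lattice: an ordered real vector space which is a lattice, in which
`n • g ≤ h` for all natural `n` forces `g = 0`, for `g` positive. -/
class ArchimedeanVectorLattice (G : Type u) [AddCommGroup G] [Lattice G] [Module ℝ G] : Prop
    extends IsOrderedAddMonoid G, IsOrderedModule ℝ G where
  archimedean : ∀ g h : G, 0 ≤ g → (∀ n : ℕ, n • g ≤ h) → g = 0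

/-- The positive cone `G⁺`. -/
abbrev PosCone (G : Type u) [AddCommGroup G] [Lattice G] : Type u := {g : G // 0 ≤ g}

/-- A trunc: an archimedean vector lattice with a truncation, i.e. a unary operation on its
positive cone satisfying the three axioms of a truncation. -/
class TruncatedVectorLattice (G : Type u) [AddCommGroup G] [Lattice G] [Module ℝ G] : Type u
    extends ArchimedeanVectorLattice G where
  /-- the truncation `g ↦ ḡ` -/
  bar : PosCone G → PosCone G
  inf_bar_le : ∀ g h : PosCone G, (g : G) ⊓ (bar h : G) ≤ (bar g : G)
  bar_le : ∀ g : PosCone G, (bar g : G) ≤ (g : G)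
  eq_zero_of_bar_eq_zero : ∀ g : PosCone G, (bar g : G) = 0 → (g : G) = 0
  eq_zero_of_forall_nsmul : ∀ g : PosCone G,
    (∀ n : ℕ, (bar ⟨n • (g : G), nsmul_nonneg g.2 n⟩ : G) = n • (g : G)) → (g : G) = 0

namespace TruncatedVectorLattice

/-- `f` is a component of `g` (used for positive `f`, `g`). -/
def IsComponent {G : Type u} [AddCommGroup G] [Lattice G] (f g : G) : Prop :=
  f ≤ g ∧ f ⊓ (g - f) = 0

/-- `u` is a unital component: it is in the range of the truncation, and `u ⊓ g` is a
component of `g` for each `g` in the range of the truncation. -/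
def IsUnitalComponent {G : Type u} [AddCommGroup G] [Lattice G] [Module ℝ G] [TruncatedVectorLattice G]
    (u : PosCone G) : Prop :=
  u ∈ Set.range (bar : PosCone G → PosCone G) ∧
    ∀ g ∈ Set.range (bar : PosCone G → PosCone G), IsComponent ((u : G) ⊓ (g : G)) (g : G)

/-- The simple part of a trunc: the set of linear combinations of unital components. -/
def simplePart (G : Type u) [AddCommGroup G] [Lattice G] [Module ℝ G] [TruncatedVectorLattice G] :
    Submodule ℝ G :=
  Submodule.span ℝ {x : G | ∃ u : PosCone G, IsUnitalComponent u ∧ (u : G) = x}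

/-- A trunc is simple if each of its elements is a linear combination of unital components. -/
def IsSimple (G : Type u) [AddCommGroup G] [Lattice G] [Module ℝ G] [TruncatedVectorLattice G] : Prop :=
  ∀ g : G, g ∈ simplePart G

end TruncatedVectorLattice

/-- Homomorphisms of vector lattices. -/
structure VectorLatticeHom (G : Type u) (H : Type v) [AddCommGroup G] [Lattice G] [Module ℝ G]
    [AddCommGroup H] [Lattice H] [Module ℝ H] extends G →ₗ[ℝ] H where
  map_sup : ∀ f g : G, toFun (f ⊔ g) = toFun f ⊔ toFun g
  map_inf : ∀ f g : G, toFun (f ⊓ g) = toFun f ⊓ toFun g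

/-- The map of positive cones induced by a vector lattice homomorphism. -/
def VectorLatticeHom.onPosCone {G : Type u} {H : Type v}
    [AddCommGroup G] [Lattice G] [Module ℝ G] [AddCommGroup H] [Lattice H] [Module ℝ H]
    (θ : VectorLatticeHom G H) (g : PosCone G) : PosCone H :=
  ⟨θ.toLinearMap (g : G), by
    have h := θ.map_sup 0 (g : G)
    rw [sup_eq_right.2 g.2] at h
    have h0 : θ.toFun 0 = 0 := θ.toLinearMap.map_zero
    rw [h0] at h
    exact sup_eq_right.1 h.symm⟩

/-- Truncation homomorphisms: vector lattice homomorphisms preserving the truncation. -/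
structure TruncHom (G : Type u) (H : Type v) [AddCommGroup G] [Lattice G] [Module ℝ G] [TruncatedVectorLattice G]
    [AddCommGroup H] [Lattice H] [Module ℝ H] [TruncatedVectorLattice H] extends VectorLatticeHom G H where
  map_bar : ∀ g : PosCone G,
    toVectorLatticeHom.onPosCone (TruncatedVectorLattice.bar g) = TruncatedVectorLattice.bar (toVectorLatticeHom.onPosCone g)

/-- Isomorphisms of truncs: truncation homomorphisms with a two-sided inverse which is a
truncation homomorphism. -/
structure TruncIso (G : Type u) (H : Type v) [AddCommGroup G] [Lattice G] [Module ℝ G] [TruncatedVectorLattice G]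
    [AddCommGroup H] [Lattice H] [Module ℝ H] [TruncatedVectorLattice H] where
  hom : TruncHom G H
  inv : TruncHom H G
  inv_hom : ∀ g : G, inv.toFun (hom.toFun g) = g
  hom_inv : ∀ h : H, hom.toFun (inv.toFun h) = h

/-- A Boolean pointed space: a zero-dimensional compact Hausdorff space with a designated point. -/
structure BooleanPointedSpace : Type (u + 1) where
  carrier : Type u
  [top : TopologicalSpace carrier]
  [compact : CompactSpace carrier]
  [t2 : T2Space carrier]
  zeroDim : TopologicalSpace.IsTopologicalBasis {s : Set carrier | IsClopen s}
  /-- the designated point -/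
  pt : carrier

attribute [instance] BooleanPointedSpace.top BooleanPointedSpace.compact BooleanPointedSpace.t2

namespace BooleanPointedSpace

/-- The real vector space of locally constant real functions on `X` vanishing at the designated
point, with pointwise operations. -/
def LC (X : BooleanPointedSpace.{u}) : Submodule ℝ (X.carrier → ℝ) where
  carrier := {f | IsLocallyConstant f ∧ f X.pt = 0}
  add_mem' := fun {f g} hf hg => ⟨hf.1.comp₂ hg.1 (· + ·), by simp [hf.2, hg.2]⟩
  zero_mem' := ⟨IsLocallyConstant.const 0, rfl⟩
  smul_mem' := fun c f hf => ⟨hf.1.comp (c * ·), by simp [hf.2]⟩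

/-- The pointwise lattice structure on `LC X`. -/
instance (X : BooleanPointedSpace.{u}) : Lattice X.LC :=
  Subtype.lattice
    (fun {f g} hf hg => ⟨hf.1.comp₂ hg.1 (· ⊔ ·), by simp [hf.2, hg.2]⟩)
    (fun {f g} hf hg => ⟨hf.1.comp₂ hg.1 (· ⊓ ·), by simp [hf.2, hg.2]⟩)

/-- `LC X` is a trunc, with the truncation `f ↦ (x ↦ min (f x) 1)`. -/
instance (X : BooleanPointedSpace.{u}) : TruncatedVectorLattice X.LC where
  add_le_add_left f g h k x := add_le_add_left (h x) (k.1 x)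
  smul_le_smul_of_nonneg_left c hc f g h x := mul_le_mul_of_nonneg_left (h x) hc
  smul_le_smul_of_nonneg_right f hf c d h x := mul_le_mul_of_nonneg_right h (hf x)
  archimedean g h hg H := by
    ext x
    have hgx : 0 ≤ g.1 x := hg x
    refine le_antisymm (le_of_not_gt fun hlt => ?_) hgx
    obtain ⟨n, hn⟩ := exists_lt_nsmul hlt (h.1 x)
    exact absurd (H n x) (not_le_of_gt (by simpa using hn))
  bar f := ⟨⟨fun x => min (f.1.1 x) 1, f.1.2.1.comp (min · 1), by
      change min (f.1.1 X.pt) 1 = 0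
      rw [f.1.2.2]; simp⟩, fun x => le_min (f.2 x) zero_le_one⟩
  inf_bar_le g h x := le_min inf_le_left (inf_le_right.trans (min_le_right _ _))
  bar_le g x := min_le_left _ _
  eq_zero_of_bar_eq_zero g h := by
    ext x
    have hx : min (g.1.1 x) 1 = 0 := congrFun (congrArg Subtype.val h) x
    change g.1.1 x = 0
    rcases min_choice (g.1.1 x) 1 with h1 | h1 <;> rw [h1] at hx
    · exact hx
    · exact absurd hx one_ne_zero
  eq_zero_of_forall_nsmul g H := by
    ext x
    have hgx : 0 ≤ g.1.1 x := g.2 x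
    refine le_antisymm (le_of_not_gt fun hlt => ?_) hgx
    obtain ⟨n, hn⟩ := exists_lt_nsmul hlt (1 : ℝ)
    have hx : min ((n • g.1 : X.LC).1 x) 1 = (n • g.1 : X.LC).1 x :=
      congrFun (congrArg Subtype.val (H n)) x
    have h1 : (n • g.1 : X.LC).1 x ≤ 1 := min_eq_left_iff.1 hx
    exact absurd h1 (not_le_of_gt (by simpa using hn))

end BooleanPointedSpace

/-! The space `X` consists of the trunc characters of `G`: truncation-preserving lattice
homomorphisms to the reals, with pointwise convergence and the zero character as designated point. A
unital component takes only the values 0 and 1 on characters, so each element takes finitely many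
values; hence `X` is compact and evaluations are locally constant.

Evaluation is injective because characters separate points (`exists_isTruncCharacter_ne_zero`):
modulo the elements disjoint from something outside a suitable prime lattice ideal, `G` is
one-dimensional, spanned by a unital component. It is surjective because every clopen set missing
the designated point has its indicator in `G` (`isRepresented_of_isClopen`), by compactness.

For uniqueness, an isomorphism `ψ` onto `Y.LC` sends each point of `Y` to a character. This map is a
homeomorphism onto `X`, and the compatibility condition admits no other. -/

section VectorLattice

/-! ### Prime lattice ideals and real-valued lattice homomorphisms -/

variable {G : Type u} [AddCommGroup G] [Lattice G] [IsOrderedAddMonoid G]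

lemma add_inf_eq_zero_of_inf_eq_zero {a b f : G} (ha : 0 ≤ a) (hb : 0 ≤ b) (hf : 0 ≤ f)
    (haf : a ⊓ f = 0) (hbf : b ⊓ f = 0) : (a + b) ⊓ f = 0 := by
  refine le_antisymm ?_ (le_inf (add_nonneg ha hb) hf)
  have h : (a + b) ⊓ f - a ≤ b ⊓ f :=
    le_inf (sub_le_iff_le_add'.2 inf_le_left) ((sub_le_self _ ha).trans inf_le_right)
  rw [hbf, sub_nonpos] at h
  exact (le_inf h inf_le_right).trans haf.le

omit [IsOrderedAddMonoid G] in
lemma inf_eq_zero_of_le {a b f : G} (ha : 0 ≤ a) (hab : a ≤ b) (h : b ⊓ f = 0) : a ⊓ f = 0 :=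
  le_antisymm ((inf_le_inf_right f hab).trans h.le) (le_inf ha (h.ge.trans inf_le_right))

variable [Module ℝ G] [IsOrderedModule ℝ G]

omit [IsOrderedAddMonoid G] in
lemma abs_smul_le_smul_abs (c : ℝ) (g : G) : |c • g| ≤ |c| • |g| := by
  have key : ∀ h : G, |h| = |g| → ∀ d : ℝ, 0 ≤ d → |d| = |c| → d • h ≤ |c| • |g| := by
    intro h hh d hd hdc
    rw [← hdc, abs_of_nonneg hd, ← hh]
    exact smul_le_smul_of_nonneg_left (le_abs_self h) hd
  rcases le_total 0 c with hc | hc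
  · refine abs_le'.2 ⟨key g rfl c hc rfl, ?_⟩
    rw [← smul_neg]
    exact key (-g) (abs_neg g) c hc rfl
  · refine abs_le'.2 ⟨?_, ?_⟩
    · rw [← neg_smul_neg]
      exact key (-g) (abs_neg g) (-c) (by linarith) (abs_neg c)
    · rw [← neg_smul]
      exact key g rfl (-c) (by linarith) (abs_neg c)

lemma smul_le_smul_of_le_right {c d : ℝ} (hcd : c ≤ d) {g : G} (hg : 0 ≤ g) : c • g ≤ d • g :=
  smul_le_smul_of_nonneg_right hcd hg

/-- A prime lattice ideal none of whose elements has a multiple dominating a given positive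
element. -/
lemma exists_prime_ideal_of_pos {g : G} (hg : 0 ≤ g) (hg0 : g ≠ 0) :
    ∃ J : Order.Ideal G, (∀ x y, x ⊓ y ∈ J → x ∈ J ∨ y ∈ J) ∧ (0 : G) ∈ J ∧
      ∀ (c : ℝ) (h : G), 0 < c → g ≤ c • h → h ∉ J := by
  let _ : DistribLattice G := AddCommGroup.toDistribLattice G
  -- This filter misses the ideal of elements below 0 because `g ≠ 0`, so the prime ideal theorem
  -- for distributive lattices separates the two.
  have hF : Order.IsPFilter {h : G | 0 ≤ h ∧ ∃ c : ℝ, 0 < c ∧ g ≤ c • h} := by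
    refine Order.IsPFilter.of_def ⟨g, hg, 1, one_pos, by simp⟩ ?_ ?_
    · rintro h ⟨hh, c, hc, hgh⟩ k ⟨hk, d, hd, hgk⟩
      refine ⟨h ⊓ k, ⟨le_inf hh hk, max c d, lt_max_of_lt_left hc, ?_⟩, inf_le_left, inf_le_right⟩
      have e : max c d • (h ⊓ k) = max c d • h ⊓ max c d • k :=
        (OrderIso.smulRight (β := G) (lt_max_of_lt_left hc : 0 < max c d)).map_inf h k
      rw [e]
      exact le_inf (hgh.trans (smul_le_smul_of_le_right (le_max_left _ _) hh))
        (hgk.trans (smul_le_smul_of_le_right (le_max_right _ _) hk))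
    · rintro h k hhk ⟨hh, c, hc, hgh⟩
      exact ⟨hh.trans hhk, c, hc, hgh.trans (smul_le_smul_of_nonneg_left hhk hc.le)⟩
  have hdisj : Disjoint (hF.toPFilter : Set G) (Order.Ideal.principal (0 : G) : Set G) := by
    rw [Set.disjoint_left]
    rintro h ⟨-, c, hc, hgh⟩ (h0 : h ≤ 0)
    exact hg0 (le_antisymm (hgh.trans (smul_nonpos_of_nonneg_of_nonpos hc.le h0)) hg)
  obtain ⟨J, hJ, h0J, hFJ⟩ := DistribLattice.prime_ideal_of_disjoint_filter_ideal hdisj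
  refine ⟨J, fun x y h => hJ.mem_or_mem h, h0J (le_refl (0 : G)), fun c h hc hgh hh => ?_⟩
  suffices h0 : 0 ≤ h from Set.disjoint_left.1 hFJ ⟨h0, c, hc, hgh⟩ hh
  exact (OrderIso.smulRight (β := G) hc).le_iff_le.1 (by simpa using hg.trans hgh)

/-- The elements disjoint from some element outside a prime lattice ideal. -/
def disjointSubmodule (J : Order.Ideal G) (hJ : ∀ x y, x ⊓ y ∈ J → x ∈ J ∨ y ∈ J)
    (hne : ∃ f : G, f ∉ J ∧ 0 ≤ f) : Submodule ℝ G where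
  carrier := {g | ∃ f ∉ J, |g| ⊓ f = 0}
  zero_mem' := by
    obtain ⟨f, hf, hf0⟩ := hne
    exact ⟨f, hf, by simpa using hf0⟩
  add_mem' := by
    rintro a b ⟨f, hf, haf⟩ ⟨k, hk, hbk⟩
    have hf0 : 0 ≤ f := haf.ge.trans inf_le_right
    have hk0 : 0 ≤ k := hbk.ge.trans inf_le_right
    -- Primeness keeps the common witness `f ⊓ k` outside `J`.
    refine ⟨f ⊓ k, fun h => (hJ _ _ h).elim hf hk, ?_⟩
    refine inf_eq_zero_of_le (abs_nonneg _) (abs_add_le a b) ?_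
    refine add_inf_eq_zero_of_inf_eq_zero (abs_nonneg _) (abs_nonneg _) (le_inf hf0 hk0) ?_ ?_
    · rw [← inf_assoc, haf, inf_eq_left.2 hk0]
    · rw [inf_comm f k, ← inf_assoc, hbk, inf_eq_left.2 hf0]
  smul_mem' := by
    rintro c g ⟨f, hf, hgf⟩
    have hf0 : 0 ≤ f := hgf.ge.trans inf_le_right
    refine ⟨f, hf, ?_⟩
    have hn : ∀ n : ℕ, (n • |g|) ⊓ f = 0 := by
      intro n
      induction n with
      | zero => simpa using hf0
      | succ n ih =>
        rw [succ_nsmul]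
        exact add_inf_eq_zero_of_inf_eq_zero (nsmul_nonneg (abs_nonneg g) n) (abs_nonneg g) hf0
          ih hgf
    obtain ⟨n, hn'⟩ := exists_nat_ge |c|
    refine inf_eq_zero_of_le (abs_nonneg _) ((abs_smul_le_smul_abs c g).trans ?_) (hn n)
    rw [← Nat.cast_smul_eq_nsmul ℝ]
    exact smul_le_smul_of_le_right hn' (abs_nonneg g)

lemma mem_disjointSubmodule_of_abs_le {J : Order.Ideal G}
    {hJ : ∀ x y, x ⊓ y ∈ J → x ∈ J ∨ y ∈ J} {hne : ∃ f : G, f ∉ J ∧ 0 ≤ f} {g h : G}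
    (hh : h ∈ disjointSubmodule J hJ hne) (hgh : |g| ≤ |h|) : g ∈ disjointSubmodule J hJ hne := by
  obtain ⟨f, hf, hhf⟩ := hh
  exact ⟨f, hf, inf_eq_zero_of_le (abs_nonneg _) hgh hhf⟩

/-- If `u > 0` spans a vector lattice modulo a solid subspace not containing `u`, then the
coefficient of `u` is a lattice homomorphism to the reals. -/
lemma exists_linearMap_of_solid {P : Submodule ℝ G} (hP : ∀ g h : G, h ∈ P → |g| ≤ |h| → g ∈ P)
    {u : G} (hu : 0 ≤ u) (huP : u ∉ P) (hspan : ∀ g : G, ∃ t : ℝ, g - t • u ∈ P) :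
    ∃ x : G →ₗ[ℝ] ℝ, x u = 1 ∧ (∀ g, x g = 0 ↔ g ∈ P) ∧ (∀ g h, x (g ⊔ h) = x g ⊔ x h) ∧
      ∀ g h, x (g ⊓ h) = x g ⊓ x h := by
  choose x hx using hspan
  -- Since `u ∉ P` the coefficient is unique, so each algebraic identity for `x` reduces to a
  -- membership in `P`.
  have huniq : ∀ (g : G) (t : ℝ), g - t • u ∈ P → x g = t := by
    intro g t ht
    by_contra hne
    have h1 : (x g - t) • u ∈ P := by
      have := P.sub_mem ht (hx g)
      rwa [sub_sub_sub_cancel_left, ← sub_smul] at this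
    exact huP ((P.smul_mem_iff (sub_ne_zero.2 hne)).1 h1)
  have hadd : ∀ g h, x (g + h) = x g + x h := fun g h => huniq _ _ <| by
    have := P.add_mem (hx g) (hx h)
    rwa [sub_add_sub_comm, ← add_smul] at this
  -- Solidity allows replacing the two arguments of the supremum, one at a time, by their multiples
  -- of `u` modulo `P`.
  have hsup1 : ∀ g h, x g ≤ x h → x (g ⊔ h) = x h := fun g h hgh => huniq _ _ <| by
    have e : x h • u = x g • u ⊔ x h • u :=
      (sup_eq_right.2 (smul_le_smul_of_le_right hgh hu)).symm
    have h1 : g ⊔ h - (x g • u) ⊔ h ∈ P := hP _ _ (hx g) (abs_sup_sub_sup_le_abs _ _ _)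
    have h2 : (x g • u) ⊔ h - (x g • u) ⊔ (x h • u) ∈ P := by
      refine hP _ _ (hx h) ?_
      rw [sup_comm, sup_comm (x g • u) (x h • u)]
      exact abs_sup_sub_sup_le_abs _ _ _
    have := P.add_mem h1 h2
    rwa [sub_add_sub_cancel, ← e] at this
  have hsup : ∀ g h, x (g ⊔ h) = x g ⊔ x h := by
    intro g h
    rcases le_total (x g) (x h) with hgh | hgh
    · rw [hsup1 g h hgh, sup_eq_right.2 hgh]
    · rw [sup_comm, hsup1 h g hgh, sup_eq_left.2 hgh]
  refine ⟨{ toFun := x, map_add' := hadd, map_smul' := fun c g => huniq _ _ ?_ }, ?_, ?_, hsup, ?_⟩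
  · have := P.smul_mem c (hx g)
    rwa [smul_sub, smul_smul] at this
  · exact huniq _ _ (by simp)
  · intro g
    refine ⟨fun h => ?_, fun h => huniq _ _ (by simpa using h)⟩
    have := hx g
    rwa [show x g = 0 from h, zero_smul, sub_zero] at this
  · intro g h
    have h1 := hadd (g ⊓ h) (g ⊔ h)
    rw [inf_add_sup, hadd, hsup, ← inf_add_sup (x g) (x h)] at h1
    exact (add_right_cancel h1).symm

end VectorLattice

/-! ### Trunc characters and separation of points -/

open TruncatedVectorLattice

/-- The truncation preserving vector lattice homomorphisms to the reals. -/
structure IsTruncCharacter {G : Type u} [AddCommGroup G] [Lattice G] [Module ℝ G]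
    [TruncatedVectorLattice G] (x : G → ℝ) : Prop where
  map_add : ∀ g h, x (g + h) = x g + x h
  map_smul : ∀ (c : ℝ) g, x (c • g) = c * x g
  map_sup : ∀ g h, x (g ⊔ h) = x g ⊔ x h
  map_inf : ∀ g h, x (g ⊓ h) = x g ⊓ x h
  map_bar : ∀ g : PosCone G, x (bar g : G) = min (x (g : G)) 1

section Trunc

variable {G : Type u} [AddCommGroup G] [Lattice G] [Module ℝ G] [TruncatedVectorLattice G]

/-- A linear lattice homomorphism to the reals with value `1` at some unital component preserves
the truncation. -/
lemma TruncatedVectorLattice.IsUnitalComponent.isTruncCharacter {u : PosCone G} (hu : IsUnitalComponent u)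
    {x : G →ₗ[ℝ] ℝ} (hxu : x (u : G) = 1) (hsup : ∀ g h, x (g ⊔ h) = x g ⊔ x h)
    (hinf : ∀ g h, x (g ⊓ h) = x g ⊓ x h) : IsTruncCharacter (x : G → ℝ) where
  map_add := x.map_add
  map_smul c g := by simp
  map_sup := hsup
  map_inf := hinf
  map_bar g := by
    have hmono : ∀ a b : G, a ≤ b → x a ≤ x b := fun a b hab => by
      have := hsup a b
      rw [sup_eq_right.2 hab] at this
      exact sup_eq_right.1 this.symm
    obtain ⟨⟨w, hw⟩, hcomp⟩ := hu
    have h1 := hmono _ _ (inf_bar_le g w)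
    rw [hw, hinf, hxu] at h1
    have h2 := hmono _ _ (bar_le g)
    have h3 := congrArg x (hcomp _ ⟨g, rfl⟩).2
    rw [hinf, map_sub, hinf, hxu, map_zero] at h3
    have h0 : 0 ≤ x (bar g : G) := by simpa using hmono _ _ (bar g).2
    -- A value `t > 1` would turn the component identity `h3` into `min 1 (t - 1) = 0`.
    have hle : x (bar g : G) ≤ 1 := by
      by_contra! hlt
      rw [inf_eq_left.2 hlt.le] at h3
      rcases min_choice (1 : ℝ) (x (bar g : G) - 1) with h | h <;>
        · change min _ _ = _ at h3
          linarith
    exact le_antisymm (le_min h2 hle) h1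

namespace IsTruncCharacter

variable {x : G → ℝ}

lemma map_zero (hx : IsTruncCharacter x) : x 0 = 0 := by
  simpa using hx.map_smul 0 0

lemma map_neg (hx : IsTruncCharacter x) (g : G) : x (-g) = -x g := by
  simpa using hx.map_smul (-1) g

lemma map_sub (hx : IsTruncCharacter x) (g h : G) : x (g - h) = x g - x h := by
  rw [sub_eq_add_neg, hx.map_add, hx.map_neg, sub_eq_add_neg]

lemma nonneg (hx : IsTruncCharacter x) {g : G} (hg : 0 ≤ g) : 0 ≤ x g := by
  have := hx.map_sup 0 g
  rw [sup_eq_right.2 hg, hx.map_zero] at this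
  exact sup_eq_right.1 this.symm

lemma eq_zero_or_one (hx : IsTruncCharacter x) {u : PosCone G} (hu : IsUnitalComponent u) :
    x (u : G) = 0 ∨ x (u : G) = 1 := by
  have h0 := hx.nonneg u.2
  obtain ⟨⟨w, hw⟩, hcomp⟩ := hu
  have h1 : x (u : G) ≤ 1 := by rw [← hw, hx.map_bar]; exact min_le_right _ _
  -- Testing on the truncation of `2u`: with `t = x u`, the identity `min t (min (2t) 1 - t) = 0`
  -- forces `t` to be 0 or 1.
  have h2 := congrArg x (hcomp _ ⟨⟨(2 : ℝ) • (u : G), smul_nonneg (by norm_num) u.2⟩, rfl⟩).2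
  simp only [hx.map_inf, hx.map_sub, hx.map_bar, hx.map_smul, hx.map_zero] at h2
  have h3 : x (u : G) ≤ min (2 * x (u : G)) 1 := le_min (by linarith) h1
  rw [inf_eq_left.2 h3] at h2
  change min _ _ = _ at h2
  rcases min_choice (x (u : G)) (min (2 * x (u : G)) 1 - x (u : G)) with h | h
  · left; linarith
  · rcases min_choice (2 * x (u : G)) 1 with h' | h'
    · left; linarith
    · right; linarith

end IsTruncCharacter

/-- Splits `u` into two disjoint pieces, between which a prime ideal must choose. -/
lemma TruncatedVectorLattice.IsUnitalComponent.inf_sub_eq_zero {u v : PosCone G} (hu : IsUnitalComponent u)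
    (hv : IsUnitalComponent v) : ((u : G) - (u : G) ⊓ v) ⊓ ((u : G) ⊓ v) = 0 := by
  have := (hv.2 u hu.1).2
  rwa [inf_comm, inf_comm (v : G) u] at this

/-- The trunc characters of a simple trunc separate its points. -/
theorem exists_isTruncCharacter_ne_zero (hG : IsSimple G) {g : G} (hg : g ≠ 0) :
    ∃ x : G → ℝ, IsTruncCharacter x ∧ x g ≠ 0 := by
  obtain ⟨J, hJ, h0J, hgJ⟩ := exists_prime_ideal_of_pos (abs_nonneg g) <| fun h =>
      hg (le_antisymm (h ▸ le_abs_self g) (neg_nonpos.1 (h ▸ neg_le_abs g)))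
  -- Otherwise, as unital components span `G`, `|g|` would lie below a positive multiple of an
  -- element of `J`.
  have hu : ∃ u : PosCone G, IsUnitalComponent u ∧ (u : G) ∉ J := by
    by_contra! hall
    have key : ∀ h : G, ∃ k ∈ J, 0 ≤ k ∧ ∃ c : ℝ, 0 < c ∧ |h| ≤ c • k := by
      intro h
      induction hG h using Submodule.span_induction with
      | mem x hx =>
        obtain ⟨u, hu, rfl⟩ := hx
        exact ⟨u, hall u hu, u.2, 1, one_pos, by rw [abs_of_nonneg u.2, one_smul]⟩
      | zero => exact ⟨0, h0J, le_rfl, 1, one_pos, by simp⟩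
      | add a b _ _ ha hb =>
        obtain ⟨k, hk, hk0, c, hc, hak⟩ := ha
        obtain ⟨l, hl, hl0, d, hd, hbl⟩ := hb
        refine ⟨k ⊔ l, Order.Ideal.sup_mem hk hl, le_sup_of_le_left hk0, c + d, by positivity, ?_⟩
        rw [add_smul]
        exact (abs_add_le a b).trans (add_le_add
          (hak.trans (smul_le_smul_of_nonneg_left le_sup_left hc.le))
          (hbl.trans (smul_le_smul_of_nonneg_left le_sup_right hd.le)))
      | smul r a _ ha =>
        obtain ⟨k, hk, hk0, c, hc, hak⟩ := ha
        refine ⟨k, hk, hk0, |r| * c + 1, by positivity, (abs_smul_le_smul_abs r a).trans ?_⟩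
        calc |r| • |a| ≤ |r| • c • k := smul_le_smul_of_nonneg_left hak (abs_nonneg r)
          _ = (|r| * c) • k := smul_smul _ _ _
          _ ≤ (|r| * c + 1) • k := smul_le_smul_of_le_right (by linarith) hk0
    obtain ⟨k, hk, -, c, hc, h⟩ := key g
    exact hgJ c k hc h hk
  obtain ⟨u, hu, huJ⟩ := hu
  let P := disjointSubmodule J hJ ⟨u, huJ, u.2⟩
  have hPsolid : ∀ a b : G, b ∈ P → |a| ≤ |b| → a ∈ P := fun a b hb =>
    mem_disjointSubmodule_of_abs_le hb
  have hnot : ∀ a : G, |a| ∉ J → a ∉ P := by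
    rintro a ha ⟨f, hf, haf⟩
    exact (hJ _ _ (haf ▸ h0J)).elim ha hf
  have huP : (u : G) ∉ P := hnot _ (by rwa [abs_of_nonneg u.2])
  have hspan : ∀ h : G, ∃ t : ℝ, h - t • (u : G) ∈ P := by
    intro h
    induction hG h using Submodule.span_induction with
    | mem x hx =>
      obtain ⟨v, hv, rfl⟩ := hx
      have huv := hu.inf_sub_eq_zero hv
      -- If `u ⊓ v ∈ J`, the rest of `u` is outside `J` and disjoint from `v`, so `v ∈ P`. If not,
      -- `u ⊓ v` witnesses that `u` and `v` agree modulo `P`.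
      by_cases hcase : (u : G) ⊓ v ∈ J
      · have hw : (u : G) - (u : G) ⊓ v ∉ J := fun h => huJ <| by
          have := Order.Ideal.sup_mem h hcase
          have e := inf_add_sup ((u : G) - (u : G) ⊓ v) ((u : G) ⊓ v)
          rw [huv, zero_add, sub_add_cancel] at e
          rwa [e] at this
        refine ⟨0, (u : G) - (u : G) ⊓ v, hw, ?_⟩
        rw [zero_smul, sub_zero, abs_of_nonneg v.2]
        refine le_antisymm ?_ (le_inf v.2 (sub_nonneg.2 inf_le_left))
        refine le_trans (le_inf inf_le_right ?_) huv.le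
        exact le_inf (inf_le_right.trans (sub_le_self _ (le_inf u.2 v.2))) inf_le_left
      · have huv' := hv.inf_sub_eq_zero hu
        rw [inf_comm (v : G)] at huv'
        have h1 : (u : G) - (u : G) ⊓ v ∈ P :=
          ⟨_, hcase, by rwa [abs_of_nonneg (sub_nonneg.2 inf_le_left)]⟩
        have h2 : (v : G) - (u : G) ⊓ v ∈ P :=
          ⟨_, hcase, by rwa [abs_of_nonneg (sub_nonneg.2 inf_le_right)]⟩
        refine ⟨1, ?_⟩
        have := P.sub_mem h2 h1
        rwa [sub_sub_sub_cancel_right, ← one_smul ℝ (u : G)] at this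
    | zero => exact ⟨0, by simp⟩
    | add a b _ _ ha hb =>
      obtain ⟨s, hs⟩ := ha
      obtain ⟨t, ht⟩ := hb
      refine ⟨s + t, ?_⟩
      have := P.add_mem hs ht
      rwa [sub_add_sub_comm, ← add_smul] at this
    | smul c a _ ha =>
      obtain ⟨t, ht⟩ := ha
      refine ⟨c * t, ?_⟩
      have := P.smul_mem c ht
      rwa [smul_sub, smul_smul] at this
  obtain ⟨x, hxu, hxP, hsup, hinf⟩ := exists_linearMap_of_solid hPsolid u.2 huP hspan
  refine ⟨x, hu.isTruncCharacter hxu hsup hinf, fun h => ?_⟩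
  exact hnot g (hgJ 1 _ one_pos (by simp)) ((hxP g).1 h)

end Trunc

/-! ### The character space and the evaluation map -/

section CharacterSpace

variable (G : Type u) [AddCommGroup G] [Lattice G] [Module ℝ G] [TruncatedVectorLattice G]

/-- The space of trunc characters, with the topology of pointwise convergence. -/
abbrev TruncCharacterSpace : Type u := {x : G → ℝ // IsTruncCharacter x}

variable {G}

lemma isTruncCharacter_zero : IsTruncCharacter (0 : G → ℝ) := by
  constructor <;> simp

lemma isClosed_setOf_isTruncCharacter : IsClosed {x : G → ℝ | IsTruncCharacter x} := by
  have e : {x : G → ℝ | IsTruncCharacter x} =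
      {x | ∀ g h, x (g + h) = x g + x h} ∩ {x | ∀ (c : ℝ) g, x (c • g) = c * x g} ∩
      {x | ∀ g h, x (g ⊔ h) = x g ⊔ x h} ∩ {x | ∀ g h, x (g ⊓ h) = x g ⊓ x h} ∩
      {x | ∀ g : PosCone G, x (bar g : G) = min (x (g : G)) 1} := by
    ext x
    exact ⟨fun h => ⟨⟨⟨⟨h.1, h.2⟩, h.3⟩, h.4⟩, h.5⟩, fun h => ⟨h.1.1.1.1, h.1.1.1.2, h.1.1.2, h.1.2, h.2⟩⟩
  rw [e]
  simp only [Set.ofPred_forall]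
  refine IsClosed.inter (IsClosed.inter (IsClosed.inter (IsClosed.inter ?_ ?_) ?_) ?_) ?_
  all_goals
    repeat refine isClosed_iInter fun _ => ?_
    exact isClosed_eq (by fun_prop) (by fun_prop)

/-- In a simple trunc, each element takes only finitely many values under trunc characters. -/
lemma finite_setOf_apply (hG : IsSimple G) (g : G) :
    {r : ℝ | ∃ x : G → ℝ, IsTruncCharacter x ∧ x g = r}.Finite := by
  induction hG g using Submodule.span_induction with
  | mem g hg =>
    obtain ⟨u, hu, rfl⟩ := hg
    refine (Set.toFinite {0, 1}).subset ?_
    rintro _ ⟨x, hx, rfl⟩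
    simpa using hx.eq_zero_or_one hu
  | zero =>
    refine (Set.finite_singleton 0).subset ?_
    rintro _ ⟨x, hx, rfl⟩
    exact hx.map_zero
  | add a b _ _ ha hb =>
    refine (ha.image2 (· + ·) hb).subset ?_
    rintro _ ⟨x, hx, rfl⟩
    exact ⟨x a, ⟨x, hx, rfl⟩, x b, ⟨x, hx, rfl⟩, (hx.map_add a b).symm⟩
  | smul c a _ ha =>
    refine (ha.image (c * ·)).subset ?_
    rintro _ ⟨x, hx, rfl⟩
    exact ⟨x a, ⟨x, hx, rfl⟩, (hx.map_smul c a).symm⟩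

/-- The characters form a closed subset of a product of finite sets of values. -/
lemma compactSpace_truncCharacterSpace (hG : IsSimple G) : CompactSpace (TruncCharacterSpace G) := by
  refine isCompact_iff_compactSpace.1 ?_
  refine (isCompact_univ_pi fun g => (finite_setOf_apply hG g).isCompact).of_isClosed_subset
    isClosed_setOf_isTruncCharacter fun x hx g _ => ⟨x, hx, rfl⟩

lemma isLocallyConstant_of_continuous_of_finite {X : Type*} [TopologicalSpace X] {f : X → ℝ}
    (hf : Continuous f) {s : Set ℝ} (hs : s.Finite) (hfs : ∀ x, f x ∈ s) : IsLocallyConstant f := by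
  have : Finite s := hs
  have h : Continuous fun x => (⟨f x, hfs x⟩ : s) := by fun_prop
  exact (IsLocallyConstant.iff_continuous _).2 h |>.comp Subtype.val

lemma isLocallyConstant_apply (hG : IsSimple G) (g : G) :
    IsLocallyConstant fun x : TruncCharacterSpace G => x.1 g :=
  isLocallyConstant_of_continuous_of_finite
    ((continuous_apply g).comp continuous_subtype_val) (finite_setOf_apply hG g)
    fun x => ⟨x.1, x.2, rfl⟩

lemma totallySeparatedSpace_truncCharacterSpace (hG : IsSimple G) :
    TotallySeparatedSpace (TruncCharacterSpace G) := by
  rw [totallySeparatedSpace_iff_exists_isClopen]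
  intro x y hxy
  obtain ⟨g, hg⟩ : ∃ g, x.1 g ≠ y.1 g := by
    by_contra! h
    exact hxy (Subtype.ext (funext h))
  exact ⟨_, (isLocallyConstant_apply hG g).isClopen_fiber (x.1 g), rfl, fun h => hg h.symm⟩

/-- The Boolean pointed space of trunc characters of a simple trunc. -/
def truncSpectrum (hG : IsSimple G) : BooleanPointedSpace.{u} :=
  have := compactSpace_truncCharacterSpace hG
  have := totallySeparatedSpace_truncCharacterSpace hG
  { carrier := TruncCharacterSpace G
    zeroDim := isTopologicalBasis_isClopen
    pt := ⟨0, isTruncCharacter_zero⟩ }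

/-- A trunc isomorphism from a bijective truncation homomorphism. -/
noncomputable def TruncHom.toTruncIso {H : Type v} [AddCommGroup H] [Lattice H] [Module ℝ H]
    [TruncatedVectorLattice H] (θ : TruncHom G H) (hθ : Function.Bijective θ.toLinearMap) :
    TruncIso G H :=
  let e := LinearEquiv.ofBijective θ.toLinearMap hθ
  have he : ∀ h, θ.toFun (e.symm h) = h := e.apply_symm_apply
  let ι : VectorLatticeHom H G :=
    { e.symm.toLinearMap with
      map_sup := fun f g => hθ.1 <| by
        change θ.toFun (e.symm (f ⊔ g)) = θ.toFun (e.symm f ⊔ e.symm g)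
        rw [θ.map_sup, he, he, he]
      map_inf := fun f g => hθ.1 <| by
        change θ.toFun (e.symm (f ⊓ g)) = θ.toFun (e.symm f ⊓ e.symm g)
        rw [θ.map_inf, he, he, he] }
  { hom := θ
    inv :=
      { ι with
        map_bar := fun g => Subtype.ext <| hθ.1 <| by
          have h1 := θ.map_bar (ι.onPosCone g)
          have h2 : θ.onPosCone (ι.onPosCone g) = g := Subtype.ext (he g)
          rw [h2] at h1
          exact (he _).trans (congrArg Subtype.val h1).symm }
    inv_hom := e.symm_apply_apply
    hom_inv := he }

/-- Evaluation of the elements of a simple trunc at the trunc characters. -/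
def truncEval (hG : IsSimple G) : TruncHom G (truncSpectrum hG).LC where
  toFun g := ⟨fun x : TruncCharacterSpace G => x.1 g, isLocallyConstant_apply hG g, rfl⟩
  map_add' g h := Subtype.ext (funext fun x : TruncCharacterSpace G => x.2.map_add g h)
  map_smul' c g := Subtype.ext (funext fun x : TruncCharacterSpace G => x.2.map_smul c g)
  map_sup g h := Subtype.ext (funext fun x : TruncCharacterSpace G => x.2.map_sup g h)
  map_inf g h := Subtype.ext (funext fun x : TruncCharacterSpace G => x.2.map_inf g h)
  map_bar g := Subtype.ext <| Subtype.ext <|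
    funext fun x : TruncCharacterSpace G => x.2.map_bar g

lemma truncEval_injective (hG : IsSimple G) : Function.Injective (truncEval hG).toLinearMap := by
  rw [injective_iff_map_eq_zero]
  intro g hg
  by_contra hne
  obtain ⟨x, hx, hxg⟩ := exists_isTruncCharacter_ne_zero hG hne
  exact hxg (congrFun (congrArg Subtype.val hg) ⟨x, hx⟩)

/-! ### Clopen sets as elements of the trunc; surjectivity of evaluation -/

/-- The clopen sets whose indicator function is given by an element of the trunc. -/
def IsRepresented (A : Set (TruncCharacterSpace G)) : Prop :=
  ∃ g : G, ∀ x : TruncCharacterSpace G, x.1 g = A.indicator 1 x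

lemma IsRepresented.empty : IsRepresented (∅ : Set (TruncCharacterSpace G)) :=
  ⟨0, fun x => by simp [x.2.map_zero]⟩

lemma IsRepresented.union {A B : Set (TruncCharacterSpace G)} (hA : IsRepresented A)
    (hB : IsRepresented B) : IsRepresented (A ∪ B) := by
  obtain ⟨g, hg⟩ := hA
  obtain ⟨h, hh⟩ := hB
  refine ⟨g ⊔ h, fun x => ?_⟩
  rw [x.2.map_sup, hg, hh]
  by_cases ha : x ∈ A <;> by_cases hb : x ∈ B <;> simp [ha, hb]

lemma IsRepresented.inter {A B : Set (TruncCharacterSpace G)} (hA : IsRepresented A)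
    (hB : IsRepresented B) : IsRepresented (A ∩ B) := by
  obtain ⟨g, hg⟩ := hA
  obtain ⟨h, hh⟩ := hB
  refine ⟨g ⊓ h, fun x => ?_⟩
  rw [x.2.map_inf, hg, hh]
  by_cases ha : x ∈ A <;> by_cases hb : x ∈ B <;> simp [ha, hb]

lemma IsRepresented.diff {A B : Set (TruncCharacterSpace G)} (hA : IsRepresented A)
    (hB : IsRepresented B) : IsRepresented (A \ B) := by
  obtain ⟨g, hg⟩ := hA
  obtain ⟨h, hh⟩ := hB
  refine ⟨(g - h) ⊔ 0, fun x => ?_⟩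
  rw [x.2.map_sup, x.2.map_sub, x.2.map_zero, hg, hh]
  by_cases ha : x ∈ A <;> by_cases hb : x ∈ B <;> simp [ha, hb]

lemma IsRepresented.isClopen (hG : IsSimple G) {A : Set (TruncCharacterSpace G)}
    (hA : IsRepresented A) : IsClopen A := by
  obtain ⟨g, hg⟩ := hA
  convert (isLocallyConstant_apply hG g).isClopen_fiber 1 using 1
  ext x
  by_cases ha : x ∈ A <;> simp [hg, ha]

lemma TruncatedVectorLattice.IsUnitalComponent.isRepresented {u : PosCone G} (hu : IsUnitalComponent u) :
    IsRepresented {x : TruncCharacterSpace G | x.1 (u : G) = 1} :=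
  ⟨u, fun x => by rcases x.2.eq_zero_or_one hu with h | h <;> simp [h]⟩

lemma exists_isUnitalComponent_apply_ne (hG : IsSimple G) {x y : G → ℝ} (hx : IsTruncCharacter x)
    (hy : IsTruncCharacter y) (hxy : x ≠ y) :
    ∃ u : PosCone G, IsUnitalComponent u ∧ x (u : G) ≠ y (u : G) := by
  by_contra! h
  refine hxy (funext fun g => ?_)
  induction hG g using Submodule.span_induction with
  | mem g hg =>
    obtain ⟨u, hu, rfl⟩ := hg
    exact h u hu
  | zero => rw [hx.map_zero, hy.map_zero]
  | add a b _ _ ha hb => rw [hx.map_add, hy.map_add, ha, hb]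
  | smul c a _ ha => rw [hx.map_smul, hy.map_smul, ha]

/-- The whole space is not represented, since elements of `G` vanish at the zero character. So when
`u` is 0 at `x` and 1 at `y`, the complement of its set is cut down by a component `v` with `x v =
1`; this needs `x ≠ 0`. -/
lemma exists_isRepresented_separating (hG : IsSimple G) {x y : TruncCharacterSpace G}
    (hxy : x ≠ y) (hx0 : x.1 ≠ 0) : ∃ A, IsRepresented A ∧ x ∈ A ∧ y ∉ A := by
  obtain ⟨u, hu, hne⟩ := exists_isUnitalComponent_apply_ne hG x.2 y.2 (fun h => hxy (Subtype.ext h))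
  obtain ⟨v, hv, hvne⟩ := exists_isUnitalComponent_apply_ne hG x.2 isTruncCharacter_zero hx0
  have hxv : x.1 (v : G) = 1 := (x.2.eq_zero_or_one hv).resolve_left hvne
  rcases x.2.eq_zero_or_one hu with hxu | hxu <;> rcases y.2.eq_zero_or_one hu with hyu | hyu
  · exact absurd (hxu.trans hyu.symm) hne
  · exact ⟨_, hv.isRepresented.diff hu.isRepresented, by simp [hxu, hxv], by simp [hyu]⟩
  · exact ⟨_, hu.isRepresented, by simp [hxu], by simp [hyu]⟩
  · exact absurd (hxu.trans hyu.symm) hne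

/-- Compactness is used twice: on the complement of `A`, to shrink a represented neighbourhood of a
point into `A` by finite intersection, then on `A`, to cover it by a finite union of these. -/
lemma isRepresented_of_isClopen (hG : IsSimple G) {A : Set (TruncCharacterSpace G)}
    (hA : IsClopen A) (h0 : ⟨0, isTruncCharacter_zero⟩ ∉ A) : IsRepresented A := by
  have := compactSpace_truncCharacterSpace hG
  have hpt : ∀ x ∈ A, ∃ B, IsRepresented B ∧ x ∈ B ∧ B ⊆ A := by
    intro x hx
    have hx0 : x.1 ≠ 0 := fun h => h0 (by
      have e : x = ⟨0, isTruncCharacter_zero⟩ := Subtype.ext h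
      rwa [e] at hx)
    -- `C` stands in for the empty intersection.
    obtain ⟨C, hC, hxC, -⟩ := exists_isRepresented_separating hG
      (y := ⟨0, isTruncCharacter_zero⟩) (fun h => hx0 (congrArg Subtype.val h)) hx0
    obtain ⟨B, hB, hxB, hdisj⟩ := hA.compl.isClosed.isCompact.induction_on
      (p := fun s => ∃ B, IsRepresented B ∧ x ∈ B ∧ Disjoint s B) ⟨C, hC, hxC, by simp⟩
      (fun s t hst ⟨B, hB, hxB, h⟩ => ⟨B, hB, hxB, h.mono_left hst⟩)
      (fun s t ⟨B, hB, hxB, h⟩ ⟨B', hB', hxB', h'⟩ => ⟨B ∩ B', hB.inter hB', ⟨hxB, hxB'⟩,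
        Set.disjoint_union_left.2 ⟨h.mono_right Set.inter_subset_left,
          h'.mono_right Set.inter_subset_right⟩⟩)
      (fun y hy => by
        obtain ⟨B, hB, hxB, hyB⟩ := exists_isRepresented_separating hG
          (y := y) (fun h => hy (h ▸ hx)) hx0
        exact ⟨Bᶜ, mem_nhdsWithin_of_mem_nhds
          ((IsRepresented.isClopen hG hB).compl.isOpen.mem_nhds hyB), B, hB, hxB,
          disjoint_compl_left⟩)
    exact ⟨B, hB, hxB, Set.disjoint_compl_left_iff_subset.1 hdisj⟩
  obtain ⟨B, hB, hAB, hBA⟩ := hA.isClosed.isCompact.induction_on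
    (p := fun s => ∃ B, IsRepresented B ∧ s ⊆ B ∧ B ⊆ A)
    ⟨∅, IsRepresented.empty, by simp, by simp⟩
    (fun s t hst ⟨B, hB, h, h'⟩ => ⟨B, hB, hst.trans h, h'⟩)
    (fun s t ⟨B, hB, h, h'⟩ ⟨C, hC, k, k'⟩ => ⟨B ∪ C, hB.union hC,
      Set.union_subset_union h k, Set.union_subset h' k'⟩)
    (fun x hx => by
      obtain ⟨B, hB, hxB, hBA⟩ := hpt x hx
      exact ⟨B, mem_nhdsWithin_of_mem_nhds
        ((IsRepresented.isClopen hG hB).isOpen.mem_nhds hxB), B, hB, subset_rfl, hBA⟩)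
  rwa [hAB.antisymm hBA]

lemma truncEval_surjective (hG : IsSimple G) : Function.Surjective (truncEval hG).toLinearMap := by
  have := compactSpace_truncCharacterSpace hG
  rintro ⟨f, hf, hf0⟩
  change TruncCharacterSpace G → ℝ at f
  change IsLocallyConstant f at hf
  change f ⟨0, isTruncCharacter_zero⟩ = 0 at hf0
  -- A locally constant `f` is the finite sum of `c` times the indicator of its fibre over `c`; for
  -- `c ≠ 0` that fibre misses the designated point.
  have hrep : ∀ c : ℝ, ∃ g : G, ∀ x : TruncCharacterSpace G,
      x.1 g = c * (f ⁻¹' {c}).indicator 1 x := by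
    intro c
    rcases eq_or_ne c 0 with rfl | hc
    · exact ⟨0, fun x => by simp [x.2.map_zero]⟩
    · obtain ⟨g, hg⟩ := isRepresented_of_isClopen hG (hf.isClopen_fiber c)
        (fun h => hc (h.symm.trans hf0))
      exact ⟨c • g, fun x => by rw [x.2.map_smul, hg]; rfl⟩
  choose g hg using hrep
  let s := hf.range_finite.toFinset
  refine ⟨∑ c ∈ s, g c, Subtype.ext (funext fun x : TruncCharacterSpace G => ?_)⟩
  change x.1 (∑ c ∈ s, g c) = f x
  have hsum : x.1 (∑ c ∈ s, g c) = ∑ c ∈ s, x.1 (g c) :=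
    _root_.map_sum (AddMonoidHom.mk' x.1 x.2.map_add) g s
  rw [hsum, Finset.sum_eq_single (f x)]
  · simp [hg]
  · intro c _ hc
    rw [hg, Set.indicator_of_notMem (fun h => hc (by simpa using h.symm)), mul_zero]
  · intro h
    exact absurd (by simp [s]) h

/-- A simple trunc is isomorphic to the locally constant functions on its spectrum. -/
noncomputable def truncEvalIso (hG : IsSimple G) : TruncIso G (truncSpectrum hG).LC :=
  (truncEval hG).toTruncIso ⟨truncEval_injective hG, truncEval_surjective hG⟩

end CharacterSpace

/-! ### Uniqueness of the representing space -/

namespace BooleanPointedSpace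

variable (Y : BooleanPointedSpace.{v})

/-- The indicator function of a clopen set not containing the designated point. -/
noncomputable def indicatorLC {A : Set Y.carrier} (hA : IsClopen A) (h : Y.pt ∉ A) : Y.LC :=
  ⟨A.indicator 1, (LocallyConstant.charFn ℝ hA).isLocallyConstant, Set.indicator_of_notMem h _⟩

lemma exists_LC_apply_ne {y z : Y.carrier} (hyz : y ≠ z) : ∃ f : Y.LC, f.1 y ≠ f.1 z := by
  obtain ⟨A, hA, hyA, hAz⟩ := Y.zeroDim.mem_nhds_iff.1 (isOpen_compl_singleton.mem_nhds hyz)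
  have hzA : z ∉ A := fun h => hAz h rfl
  -- Both `A` and its complement separate `y` from `z`, and one of them misses the designated point.
  by_cases h : Y.pt ∈ A
  · refine ⟨Y.indicatorLC (IsClopen.compl hA) (by simpa using h), ?_⟩
    simp [indicatorLC, hyA, hzA]
  · refine ⟨Y.indicatorLC hA h, ?_⟩
    simp [indicatorLC, hyA, hzA]

end BooleanPointedSpace

section Uniqueness

variable {G : Type u} [AddCommGroup G] [Lattice G] [Module ℝ G] [TruncatedVectorLattice G]
  {Y : BooleanPointedSpace.{v}}

/-- Evaluation at a point, transported along a truncation homomorphism. -/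
def TruncHom.character (ψ : TruncHom G Y.LC) (y : Y.carrier) : TruncCharacterSpace G where
  val g := (ψ.toFun g).1 y
  property :=
    { map_add := fun g h => congrFun (congrArg Subtype.val (ψ.map_add' g h)) y
      map_smul := fun c g => congrFun (congrArg Subtype.val (ψ.map_smul' c g)) y
      map_sup := fun g h => congrFun (congrArg Subtype.val (ψ.map_sup g h)) y
      map_inf := fun g h => congrFun (congrArg Subtype.val (ψ.map_inf g h)) y
      map_bar := fun g =>
        congrFun (congrArg Subtype.val (congrArg Subtype.val (ψ.map_bar g))) y }

lemma TruncHom.continuous_character (ψ : TruncHom G Y.LC) : Continuous ψ.character :=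
  (continuous_pi fun g => (ψ.toFun g).2.1.continuous).subtype_mk _

lemma TruncIso.character_pt (ψ : TruncIso G Y.LC) :
    ψ.hom.character Y.pt = ⟨0, isTruncCharacter_zero⟩ :=
  Subtype.ext (funext fun g => (ψ.hom.toFun g).2.2)

lemma TruncIso.character_injective (ψ : TruncIso G Y.LC) :
    Function.Injective ψ.hom.character := by
  intro y z h
  by_contra hyz
  obtain ⟨f, hf⟩ := Y.exists_LC_apply_ne hyz
  have := congrFun (congrArg Subtype.val h) (ψ.inv.toFun f)
  change (ψ.hom.toFun (ψ.inv.toFun f)).1 y = (ψ.hom.toFun (ψ.inv.toFun f)).1 z at this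
  rw [ψ.hom_inv] at this
  exact hf this

/-- The image is compact and contains the zero character. A character outside it would have a clopen
neighbourhood missing the image, whose indicator is a nonzero element of `G` killed by `ψ`. -/
lemma TruncIso.character_surjective (hG : IsSimple G) (ψ : TruncIso G Y.LC) :
    Function.Surjective ψ.hom.character := by
  intro x
  by_contra hx
  have := compactSpace_truncCharacterSpace hG
  have := totallySeparatedSpace_truncCharacterSpace hG
  have hclosed : IsClosed (Set.range ψ.hom.character) :=
    (isCompact_range ψ.hom.continuous_character).isClosed
  obtain ⟨A, hA, hxA, hAr⟩ := compact_exists_isClopen_in_isOpen hclosed.isOpen_compl hx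
  obtain ⟨g, hg⟩ := isRepresented_of_isClopen hG hA
    (fun h => hAr h ⟨Y.pt, ψ.character_pt⟩)
  have hψ : ψ.hom.toFun g = 0 := Subtype.ext <| funext fun y =>
    (hg (ψ.hom.character y)).trans (Set.indicator_of_notMem (fun h => hAr h ⟨y, rfl⟩) _)
  have hg0 : g = 0 := by
    rw [← ψ.inv_hom g, hψ]
    exact ψ.inv.toLinearMap.map_zero
  have := hg x
  rw [hg0, x.2.map_zero, Set.indicator_of_mem hxA] at this
  exact zero_ne_one this

end Uniqueness

theorem theorem1 {G : Type u} [AddCommGroup G] [Lattice G] [Module ℝ G] [TruncatedVectorLattice G]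
    (hG : TruncatedVectorLattice.IsSimple G) :
    ∃ (X : BooleanPointedSpace.{u}) (φ : TruncIso G X.LC),
      ∀ (Y : BooleanPointedSpace.{v}) (ψ : TruncIso G Y.LC),
        ∃! k : Y.carrier ≃ₜ X.carrier, k Y.pt = X.pt ∧
          ∀ (g : G) (y : Y.carrier), (ψ.hom.toFun g).1 y = (φ.hom.toFun g).1 (k y) := by
  refine ⟨truncSpectrum hG, truncEvalIso hG, fun Y ψ => ?_⟩
  let e : Y.carrier ≃ TruncCharacterSpace G :=
    Equiv.ofBijective ψ.hom.character ⟨ψ.character_injective, ψ.character_surjective hG⟩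
  have he : Continuous e := ψ.hom.continuous_character
  let k : Y.carrier ≃ₜ TruncCharacterSpace G := he.homeoOfEquivCompactToT2
  refine ⟨k, ⟨ψ.character_pt, fun g y => rfl⟩, fun l hl => Homeomorph.ext fun y => ?_⟩
  -- The compatibility condition prescribes the value of the character `l y` at every `g`.
  exact Subtype.ext (funext fun g => (hl.2 g y).symm)
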